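/- A partition is a finite weakly decreasing sequence of positive integers, identified with its Young diagram. A skew shape $\sigma/\rho$ is the set-theoretic difference of the Young diagrams of two partitions with $\rho\subseteq\sigma$, and two skew shapes are considered equal if one is a translate of the other. A skew shape is connected if any two of its squares can be joined by a sequence of its squares in which consecutive squares share an edge. For a skew shape $\alpha$ let $\mathrm{col}(\alpha)$, $\mathrm{row}(\alpha)$ and $\mathrm{area}(\alpha)$ be its numbers of nonempty columns, nonempty rows and squares, and for an integer $k$ call the set of squares of $\alpha$ in row $i$ and column $j$ with $i-j=k$ a diagonal of $\alpha$. Let $\mathrm{CS}^{\le k}$ be the set of nonempty connected skew shapes in which every diagonal has at most $k$ squares. **Proposition.** For every integer $m\ge 0$, the following identity of formal power series holds in $\mathbb{Z}[[x,y,q]]$, the sum on the left being coefficientwise convergent: \[ \sum_{\alpha\in \mathrm{CS}^{\le m+1}} x^{\mathrm{col}(\alpha)}y^{\mathrm{row}(\alpha)}q^{\mathrm{area}(\alpha)} =\cfrac{qxy}{1-q(x+y)-\cfrac{q^3xy}{1-q^2(x+y)-\cdots-\cfrac{q^{2m+1}xy}{1-q^{m+1}(x+y)}}}, \] where the finite continued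 fraction has the $m+1$ partial numerators $q^{2i+1}xy$ and partial denominators $1-q^{i+1}(x+y)$, $0\le i\le m$ (for $m=0$ it is $qxy/(1-q(x+y))$). -/

import Mathlib

open scoped MvPowerSeries.WithPiTopology

/-- A pair of partitions `inner ⊆ outer`, given by their Young diagrams. -/
structure SkewDiagram where
  outer : YoungDiagram
  inner : YoungDiagram
  le : inner ≤ outer

/-! Cells are pairs (row, column) of integers; `Cells` collects the notions for finite sets of
cells that are used below. -/
namespace Cells

/-- The set `S` of cells translated by `v`. -/
def translate (v : ℤ × ℤ) (S : Finset (ℤ × ℤ)) : Finset (ℤ × ℤ) :=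
  S.map (Equiv.addRight v).toEmbedding

/-- Number of nonempty rows. -/
def row (S : Finset (ℤ × ℤ)) : ℕ := (S.image Prod.fst).card

/-- Number of nonempty columns. -/
def col (S : Finset (ℤ × ℤ)) : ℕ := (S.image Prod.snd).card

/-- The two cells share an edge. -/
def Adj (u v : ℤ × ℤ) : Prop := |u.1 - v.1| + |u.2 - v.2| = 1

/-- Any two cells of `S` are joined by a sequence of cells of `S` in which consecutive cells
share an edge. -/
def Connected (S : Finset (ℤ × ℤ)) : Prop :=
  ∀ u ∈ S, ∀ v ∈ S, Relation.ReflTransGen (fun a b => a ∈ S ∧ b ∈ S ∧ Adj a b) u v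

/-- The cells of `S` in row `i` and column `j` with `i - j = k`. -/
def diagonal (S : Finset (ℤ × ℤ)) (k : ℤ) : Finset (ℤ × ℤ) := S.filter fun c => c.1 - c.2 = k

/-- Every diagonal of `S` has at most `m` cells. -/
def DiagonalsLE (m : ℕ) (S : Finset (ℤ × ℤ)) : Prop := ∀ k : ℤ, (diagonal S k).card ≤ m

theorem mem_translate {v : ℤ × ℤ} {S : Finset (ℤ × ℤ)} {c : ℤ × ℤ} :
    c ∈ translate v S ↔ c - v ∈ S := by
  simp only [translate, Finset.mem_map, Equiv.coe_toEmbedding, Equiv.coe_addRight]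
  constructor
  · rintro ⟨a, ha, rfl⟩
    simpa using ha
  · intro h
    exact ⟨c - v, h, by simp⟩

theorem translate_zero (S : Finset (ℤ × ℤ)) : translate 0 S = S := by
  ext c
  simp [mem_translate]

theorem translate_translate (v w : ℤ × ℤ) (S : Finset (ℤ × ℤ)) :
    translate w (translate v S) = translate (v + w) S := by
  ext c
  simp [mem_translate, sub_sub, add_comm]

theorem card_translate (v : ℤ × ℤ) (S : Finset (ℤ × ℤ)) : (translate v S).card = S.card :=
  Finset.card_map _

theorem row_translate (v : ℤ × ℤ) (S : Finset (ℤ × ℤ)) : row (translate v S) = row S := by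
  have h : (translate v S).image Prod.fst = (S.image Prod.fst).map
      (Equiv.addRight v.1).toEmbedding := by
    simp only [translate, Finset.map_eq_image, Finset.image_image]
    rfl
  rw [row, h, Finset.card_map, row]

theorem col_translate (v : ℤ × ℤ) (S : Finset (ℤ × ℤ)) : col (translate v S) = col S := by
  have h : (translate v S).image Prod.snd = (S.image Prod.snd).map
      (Equiv.addRight v.2).toEmbedding := by
    simp only [translate, Finset.map_eq_image, Finset.image_image]
    rfl
  rw [col, h, Finset.card_map, col]

theorem Connected.translate {S : Finset (ℤ × ℤ)} (h : Connected S) (v : ℤ × ℤ) :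
    Connected (translate v S) := by
  intro a ha b hb
  have key := h (a - v) (mem_translate.1 ha) (b - v) (mem_translate.1 hb)
  have hl : ∀ c d, Relation.ReflTransGen (fun a b => a ∈ S ∧ b ∈ S ∧ Adj a b) c d →
      Relation.ReflTransGen (fun a b => a ∈ Cells.translate v S ∧
        b ∈ Cells.translate v S ∧ Adj a b) (c + v) (d + v) := by
    intro c d hcd
    induction hcd with
    | refl => exact .refl
    | tail _ hbc ih => exact ih.tail (by simpa [mem_translate, Adj] using hbc)
  simpa using hl _ _ key

theorem DiagonalsLE.translate {m : ℕ} {S : Finset (ℤ × ℤ)} (h : DiagonalsLE m S) (v : ℤ × ℤ) :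
    DiagonalsLE m (translate v S) := by
  intro k
  have : diagonal (Cells.translate v S) k =
      Cells.translate v (diagonal S (k - (v.1 - v.2))) := by
    ext c
    simp only [diagonal, Finset.mem_filter, mem_translate, Prod.fst_sub, Prod.snd_sub]
    refine and_congr_right fun _ => ?_
    omega
  rw [this, card_translate]
  exact h _

end Cells

namespace SkewDiagram

/-- The set-theoretic difference of the two Young diagrams, as cells (row, column). -/
def cells (s : SkewDiagram) : Finset (ℤ × ℤ) :=
  (s.outer.cells \ s.inner.cells).image fun c => ((c.1 : ℤ), (c.2 : ℤ))

/-- Two skew diagrams are identified when one set of cells is a translate of the other. -/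
instance setoid : Setoid SkewDiagram where
  r s t := ∃ v : ℤ × ℤ, t.cells = Cells.translate v s.cells
  iseqv :=
    { refl := fun s => ⟨0, (Cells.translate_zero _).symm⟩
      symm := by
        rintro s t ⟨v, h⟩
        exact ⟨-v, by rw [h, Cells.translate_translate, add_neg_cancel, Cells.translate_zero]⟩
      trans := by
        rintro s t u ⟨v, h⟩ ⟨w, h'⟩
        exact ⟨v + w, by rw [h', h, Cells.translate_translate]⟩ }

theorem iff_of_equiv {P : Finset (ℤ × ℤ) → Prop}
    (hP : ∀ S v, P S → P (Cells.translate v S)) {s t : SkewDiagram} (h : s ≈ t) :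
    P s.cells ↔ P t.cells := by
  constructor
  · intro hs
    obtain ⟨v, hv⟩ := h
    exact hv ▸ hP _ v hs
  · intro ht
    obtain ⟨v, hv⟩ := Setoid.symm h
    exact hv ▸ hP _ v ht

end SkewDiagram

/-- Skew shapes: skew diagrams up to translation. -/
def SkewShape : Type := Quotient SkewDiagram.setoid

namespace SkewShape

/-- Number of nonempty columns. -/
def col (α : SkewShape) : ℕ :=
  Quotient.lift (fun s : SkewDiagram => Cells.col s.cells)
    (by rintro s t ⟨v, h⟩; simp only [h, Cells.col_translate]) α

/-- Number of nonempty rows. -/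
def row (α : SkewShape) : ℕ :=
  Quotient.lift (fun s : SkewDiagram => Cells.row s.cells)
    (by rintro s t ⟨v, h⟩; simp only [h, Cells.row_translate]) α

/-- Number of squares. -/
def area (α : SkewShape) : ℕ :=
  Quotient.lift (fun s : SkewDiagram => s.cells.card)
    (by rintro s t ⟨v, h⟩; simp only [h, Cells.card_translate]) α

def Connected (α : SkewShape) : Prop :=
  Quotient.lift (fun s : SkewDiagram => Cells.Connected s.cells)
    (fun _ _ h => propext (SkewDiagram.iff_of_equiv (fun _ v hS => hS.translate v) h)) α

/-- Every diagonal has at most `m` squares. -/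
def DiagonalsLE (m : ℕ) (α : SkewShape) : Prop :=
  Quotient.lift (fun s : SkewDiagram => Cells.DiagonalsLE m s.cells)
    (fun _ _ h => propext (SkewDiagram.iff_of_equiv (fun _ v hS => hS.translate v) h)) α

/-- The set of all nonempty connected skew shapes. -/
def CS : Set SkewShape := {α | 0 < α.area ∧ α.Connected}

/-- The set of nonempty connected skew shapes in which every diagonal has at most `m` squares. -/
def CSle (m : ℕ) : Set SkewShape := {α | α ∈ CS ∧ α.DiagonalsLE m}

end SkewShape

namespace SkewGF

/-- The ring `ℤ⟦x, y, q⟧`, with the topology of coefficientwise convergence (`ℤ` discrete). -/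
abbrev PS : Type := MvPowerSeries (Fin 3) ℤ

noncomputable def x : PS := MvPowerSeries.X 0
noncomputable def y : PS := MvPowerSeries.X 1
noncomputable def q : PS := MvPowerSeries.X 2

/-- The finite continued fraction with levels `i, i + 1, …, i + n`, where level `k` has
numerator `q ^ (2k+1) x y` and partial denominator `1 - q ^ (k+1) (x + y)`. `Ring.inverse` is the
inverse in the ring `ℤ⟦x, y, q⟧`; every denominator is a unit, see `isUnit_den`. -/
noncomputable def contFrac : ℕ → ℕ → PS
  | 0, i => q ^ (2 * i + 1) * x * y * Ring.inverse (1 - q ^ (i + 1) * (x + y))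
  | n + 1, i => q ^ (2 * i + 1) * x * y *
      Ring.inverse (1 - q ^ (i + 1) * (x + y) - contFrac n (i + 1))

theorem constantCoeff_contFrac (n i : ℕ) : MvPowerSeries.constantCoeff (contFrac n i) = 0 := by
  cases n <;> simp [contFrac, x]

theorem isUnit_den (n i : ℕ) :
    IsUnit (1 - q ^ (i + 1) * (x + y)) ∧
      IsUnit (1 - q ^ (i + 1) * (x + y) - contFrac n (i + 1)) := by
  simp [MvPowerSeries.isUnit_iff_constantCoeff, constantCoeff_contFrac, x, y]

end SkewGF

/-!
Read diagonal by diagonal, a connected skew shape starts and ends with a single square, each of its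
diagonals occupies an interval of rows, and the first and the last of these rows each increase by
`0` or `1` from one diagonal to the next. Hence the shapes in which every diagonal has at most
`m + 1` squares correspond to the bicoloured Motzkin paths of height at most `m`, where the height
is the number of squares of the diagonal minus one. Let `G (k + 1)` be the generating function of
the paths that start at height `k`, and `G 0 = 1`. Removing the first step gives
`G (k + 1) = q ^ (k + 1) * ((x + y) * G (k + 1) + x * y * G (k + 2) + G k)` for `k ≤ m`, and
`G (m + 2) = 0`; solving this for the ratios `G (k + 1) / G k` from the top down produces the
continued fraction.
-/

namespace SkewGF

section ContinuedFraction

theorem contFrac_zero_mul_den (i : ℕ) :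
    contFrac 0 i * (1 - q ^ (i + 1) * (x + y)) = q ^ (2 * i + 1) * x * y := by
  rw [contFrac, mul_assoc, Ring.inverse_mul_cancel _ (isUnit_den 0 i).1, mul_one]

theorem contFrac_succ_mul_den (n i : ℕ) :
    contFrac (n + 1) i * (1 - q ^ (i + 1) * (x + y) - contFrac n (i + 1)) =
      q ^ (2 * i + 1) * x * y := by
  rw [contFrac, mul_assoc, Ring.inverse_mul_cancel _ (isUnit_den n i).2, mul_one]

theorem mul_eq_contFrac_mul {G : ℕ → PS} {n i : ℕ}
    (hG : ∀ k, i ≤ k → k ≤ i + n →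
      G (k + 1) = q ^ (k + 1) * ((x + y) * G (k + 1) + x * y * G (k + 2) + G k))
    (hend : G (i + n + 2) = 0) :
    q ^ i * x * y * G (i + 1) = contFrac n i * G i := by
  induction n generalizing i with
  | zero =>
    refine (isUnit_den 0 i).1.mul_right_cancel ?_
    have hrec := hG i le_rfl le_rfl
    rw [show G (i + 2) = 0 from hend] at hrec
    linear_combination q ^ i * x * y * hrec - G i * contFrac_zero_mul_den i
  | succ n ih =>
    refine (isUnit_den n i).2.mul_right_cancel ?_
    have hrec := hG i le_rfl (by omega)
    have hratio : q ^ (i + 1) * x * y * G (i + 2) = contFrac n (i + 1) * G (i + 1) :=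
      ih (fun k hik hkn => hG k (by omega) (by omega)) (by rw [← hend]; congr 1; omega)
    linear_combination q ^ i * x * y * hrec - G i * contFrac_succ_mul_den n i +
      q ^ i * x * y * hratio

end ContinuedFraction

section Summation

theorem hasSum_list {α M : Type*} [Fintype α] [AddCommMonoid M] [TopologicalSpace M]
    [ContinuousAdd M] {f : List α → M} {a : α → M}
    (hf : ∀ e, HasSum (fun l => f (e :: l)) (a e)) : HasSum f (f [] + ∑ e, a e) := by
  classical
  have hnil : HasSum (Pi.single [] (f [])) (f []) := hasSum_pi_single ([] : List α) (f [])
  have hcons (e : α) : HasSum (Function.extend (List.cons e) (fun l => f (e :: l)) 0) (a e) :=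
    (hasSum_extend_zero List.cons_injective).2 (hf e)
  convert hnil.add (hasSum_sum fun e _ => hcons e) using 1
  funext l
  cases l with
  | nil => simp [Function.extend_apply']
  | cons b l =>
    have hb : Function.extend (List.cons b) (fun l => f (b :: l)) 0 (b :: l) = f (b :: l) :=
      List.cons_injective.extend_apply _ _ _
    rw [Finset.sum_eq_single b, hb]
    · simp
    · intro e _ he
      rw [Function.extend_apply' _ _ _ (by simp [he]), Pi.zero_apply]
    · simp

theorem summable_of_X_pow_dvd {ι σ R : Type*} [Semiring R] [TopologicalSpace R]
    {f : ι → MvPowerSeries σ R} {s : σ} {d : ι → ℕ} (hf : ∀ i, MvPowerSeries.X s ^ d i ∣ f i)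
    (hd : ∀ n, {i | d i ≤ n}.Finite) : Summable f := by
  refine Pi.summable.2 fun e => summable_of_hasFiniteSupport ((hd (e s)).subset fun i hi => ?_)
  by_contra hlt
  exact hi (MvPowerSeries.X_pow_dvd_iff.1 (hf i) e (not_le.1 hlt))

end Summation

section Paths

/-- A step between consecutive diagonals of a skew shape: the components tell whether the first,
respectively the last, occupied row increases by one. -/
abbrev Step : Type := Bool × Bool

/-- The values `s = f 0, f 1, …` of the function that increases by one at the entries of `l`
satisfying `p`: the first, or the last, occupied row along the diagonals. -/
def boundary (p : Step → Bool) (s : ℤ) (l : List Step) (n : ℕ) : ℤ := s + (l.take n).countP p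

/-- The height after `n` steps of the bicoloured Motzkin path with steps `l` that starts at
height `h`; it is the distance between the two boundaries. -/
def height (h : ℤ) (l : List Step) (n : ℕ) : ℤ :=
  boundary Prod.snd h l n - boundary Prod.fst 0 l n

/-- The change of height in one step. -/
def rise (e : Step) : ℤ := e.2.toNat - e.1.toNat

/-- The bicoloured Motzkin paths from height `h` to height `0` that stay between the heights `0`
and `m`. -/
def paths (m : ℕ) (h : ℤ) : Set (List Step) :=
  {l | (∀ n ≤ l.length, height h l n ∈ Set.Icc 0 (m : ℤ)) ∧ height h l l.length = 0}

/-- The number of squares of the skew shape encoded by a path: a vertex of height `k` stands for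
a diagonal of `k + 1` squares. -/
def pathArea (h : ℤ) (l : List Step) : ℕ :=
  ∑ n ∈ Finset.range (l.length + 1), (height h l n + 1).toNat

/-- The weight of a step: it brings a new column, marked by `x`, when the first occupied row stays
the same, and a new row, marked by `y`, when the last occupied row increases. -/
noncomputable def stepWeight (e : Step) : PS := x ^ (!e.1).toNat * y ^ e.2.toNat

/-- The weight of a path: that of the encoded skew shape, with `q` marking area, except that the
row and the column of the initial square are not counted. -/
noncomputable def weight (h : ℤ) (l : List Step) : PS :=
  q ^ pathArea h l * (l.map stepWeight).prod

/-- The generating function of the paths from height `h` to height `0`. -/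
noncomputable def pathSum (m : ℕ) (h : ℤ) : PS := ∑' l, (paths m h).indicator (weight h) l

variable {m : ℕ} {h : ℤ}

@[simp]
theorem boundary_zero (p : Step → Bool) (s : ℤ) (l : List Step) : boundary p s l 0 = s := by
  simp [boundary]

theorem boundary_length (p : Step → Bool) (s : ℤ) (l : List Step) :
    boundary p s l l.length = s + l.countP p := by
  rw [boundary, List.take_length]

theorem boundary_cons_succ (p : Step → Bool) (s : ℤ) (e : Step) (l : List Step) (n : ℕ) :
    boundary p s (e :: l) (n + 1) = boundary p (s + (p e).toNat) l n := by
  simp only [boundary, List.take_succ_cons, List.countP_cons]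
  cases p e <;> simp [add_comm, add_left_comm]

@[simp]
theorem height_zero (h : ℤ) (l : List Step) : height h l 0 = h := by simp [height]

@[simp]
theorem height_cons_succ (h : ℤ) (e : Step) (l : List Step) (n : ℕ) :
    height h (e :: l) (n + 1) = height (h + rise e) l n := by
  rw [height, boundary_cons_succ, boundary_cons_succ]
  simp only [height, boundary, rise]
  ring

theorem nil_mem_paths : [] ∈ paths m h ↔ h = 0 := by
  simp only [paths, Set.mem_ofPred_eq, List.length_nil, Nat.le_zero, forall_eq, height_zero,
    Set.mem_Icc]
  omega

theorem cons_mem_paths {e : Step} {l : List Step} :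
    e :: l ∈ paths m h ↔ h ∈ Set.Icc 0 (m : ℤ) ∧ l ∈ paths m (h + rise e) := by
  simp only [paths, Set.mem_ofPred_eq, List.length_cons, ← Nat.lt_succ_iff, ← and_assoc,
    Nat.forall_lt_succ_left', height_zero, height_cons_succ]

theorem mem_Icc_of_mem_paths {l : List Step} (hl : l ∈ paths m h) : h ∈ Set.Icc 0 (m : ℤ) := by
  simpa using hl.1 0 (Nat.zero_le _)

theorem pathArea_nil (h : ℤ) : pathArea h [] = (h + 1).toNat := by simp [pathArea]

theorem pathArea_cons (h : ℤ) (e : Step) (l : List Step) :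
    pathArea h (e :: l) = (h + 1).toNat + pathArea (h + rise e) l := by
  rw [pathArea, List.length_cons, Finset.sum_range_succ', add_comm]
  simp only [height_zero, height_cons_succ, pathArea]

theorem length_le_pathArea {l : List Step} (hl : l ∈ paths m h) : l.length ≤ pathArea h l :=
  calc l.length ≤ ∑ n ∈ Finset.range (l.length + 1), 1 := by simp
    _ ≤ pathArea h l := Finset.sum_le_sum fun n hn => by
      have := (hl.1 n (Finset.mem_range_succ_iff.1 hn)).1
      omega

theorem weight_nil (h : ℤ) : weight h [] = q ^ (h + 1).toNat := by simp [weight, pathArea_nil]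

theorem weight_cons (h : ℤ) (e : Step) (l : List Step) :
    weight h (e :: l) = q ^ (h + 1).toNat * stepWeight e * weight (h + rise e) l := by
  rw [weight, pathArea_cons, List.map_cons, List.prod_cons, weight]
  ring

theorem weight_eq (h : ℤ) (l : List Step) :
    weight h l = x ^ l.countP (fun e => !e.1) * y ^ l.countP Prod.snd * q ^ pathArea h l := by
  have hsteps : (l.map stepWeight).prod =
      x ^ l.countP (fun e => !e.1) * y ^ l.countP Prod.snd := by
    induction l with
    | nil => simp
    | cons e l ih =>
      rw [List.map_cons, List.prod_cons, ih, stepWeight, List.countP_cons, List.countP_cons]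
      rcases e with ⟨a, b⟩
      cases a <;> cases b <;> simp <;> ring
  rw [weight, hsteps, mul_comm]

theorem hasSum_pathSum (m : ℕ) (h : ℤ) :
    HasSum ((paths m h).indicator (weight h)) (pathSum m h) := by
  refine (summable_of_X_pow_dvd (s := 2) (d := List.length) (fun l => ?_)
    (List.finite_length_le Step)).hasSum
  by_cases hl : l ∈ paths m h
  · rw [Set.indicator_of_mem hl]
    exact (pow_dvd_pow q (length_le_pathArea hl)).mul_right _
  · rw [Set.indicator_of_notMem hl]
    exact dvd_zero _

theorem pathSum_eq_zero (hh : h ∉ Set.Icc 0 (m : ℤ)) : pathSum m h = 0 := by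
  have hempty : paths m h = ∅ :=
    Set.eq_empty_of_forall_notMem fun l hl => hh (mem_Icc_of_mem_paths hl)
  simp [pathSum, hempty]

theorem pathSum_eq (hh : h ∈ Set.Icc 0 (m : ℤ)) :
    pathSum m h = q ^ (h + 1).toNat * ((x + y) * pathSum m h + x * y * pathSum m (h + 1) +
      (pathSum m (h - 1) + if h = 0 then 1 else 0)) := by
  have hcons (e : Step) : HasSum (fun l => (paths m h).indicator (weight h) (e :: l))
      (q ^ (h + 1).toNat * stepWeight e * pathSum m (h + rise e)) := by
    refine ((hasSum_pathSum m (h + rise e)).mul_left (q ^ (h + 1).toNat * stepWeight e)).congr_fun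
      fun l => ?_
    by_cases hl : l ∈ paths m (h + rise e)
    · rw [Set.indicator_of_mem hl, Set.indicator_of_mem (cons_mem_paths.2 ⟨hh, hl⟩), weight_cons]
    · rw [Set.indicator_of_notMem hl, mul_zero,
        Set.indicator_of_notMem fun hel => hl (cons_mem_paths.1 hel).2]
  have hnil : (paths m h).indicator (weight h) [] = q ^ (h + 1).toNat * if h = 0 then 1 else 0 := by
    simp only [Set.indicator, nil_mem_paths, weight_nil, mul_ite, mul_one, mul_zero]
  refine ((hasSum_pathSum m h).unique (hasSum_list hcons)).trans ?_
  rw [hnil, Fintype.sum_prod_type]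
  simp only [Fintype.sum_bool, stepWeight, rise]
  simp only [Bool.not_true, Bool.not_false, Bool.toNat_true, Bool.toNat_false, Nat.cast_one,
    Nat.cast_zero, pow_zero, pow_one, one_mul, mul_one, sub_self, sub_zero, zero_sub, add_zero,
    ← sub_eq_add_neg]
  ring

theorem mul_pathSum_zero (m : ℕ) : x * y * pathSum m 0 = contFrac m 0 := by
  let G : ℕ → PS
    | 0 => 1
    | k + 1 => pathSum m k
  have hrec (k : ℕ) (hk : k ≤ m) :
      G (k + 1) = q ^ (k + 1) * ((x + y) * G (k + 1) + x * y * G (k + 2) + G k) := by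
    have hprev : pathSum m (k - 1) + (if (k : ℤ) = 0 then 1 else 0) = G k := by
      cases k with
      | zero => simp [G, pathSum_eq_zero]
      | succ k =>
        rw [if_neg (by omega), add_zero, Nat.cast_succ, add_sub_cancel_right]
    rw [← hprev]
    exact_mod_cast pathSum_eq (m := m) (h := k) ⟨by omega, by omega⟩
  have hend : G (0 + m + 2) = 0 := pathSum_eq_zero fun h => by simpa using h.2
  simpa [G] using mul_eq_contFrac_mul (fun k _ hk => hrec k (by omega)) hend

end Paths

end SkewGF

namespace Cells

section Reachability

/-- The relation of being cells of `S` that share an edge, as it occurs in `Connected`. -/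
abbrev AdjIn (S : Finset (ℤ × ℤ)) (c d : ℤ × ℤ) : Prop := c ∈ S ∧ d ∈ S ∧ Adj c d

variable {S : Finset (ℤ × ℤ)} {u v : ℤ × ℤ}

instance : Std.Symm (AdjIn S) where
  symm c d h := by
    refine ⟨h.2.1, h.1, ?_⟩
    rw [Adj, abs_sub_comm, abs_sub_comm d.2]
    exact h.2.2

theorem reflTransGen_adjIn_of_le (hS : (S : Set (ℤ × ℤ)).OrdConnected) (hu : u ∈ S) (hv : v ∈ S)
    (huv : u ≤ v) : Relation.ReflTransGen (AdjIn S) u v := by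
  obtain ⟨huv₁, huv₂⟩ := huv
  have hmem (c : ℤ × ℤ) (huc₁ : u.1 ≤ c.1) (huc₂ : u.2 ≤ c.2) (hcv₁ : c.1 ≤ v.1)
      (hcv₂ : c.2 ≤ v.2) : c ∈ S := hS.out hu hv ⟨⟨huc₁, huc₂⟩, hcv₁, hcv₂⟩
  have hrows : Relation.ReflTransGen (AdjIn S) (u.1, u.2) (v.1, u.2) :=
    .lift (fun i => (i, u.2)) (fun _ _ => id) _ _
      (reflTransGen_of_succ_of_le (fun i i' => AdjIn S (i, u.2) (i', u.2)) (fun i hi =>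
        ⟨hmem _ hi.1 le_rfl hi.2.le huv₂, hmem _ (hi.1.trans (Order.le_succ i)) le_rfl
          (Order.succ_le_of_lt hi.2) huv₂, by simp [Adj]⟩) huv₁)
  have hcols : Relation.ReflTransGen (AdjIn S) (v.1, u.2) (v.1, v.2) :=
    .lift (fun j => (v.1, j)) (fun _ _ => id) _ _
      (reflTransGen_of_succ_of_le (fun j j' => AdjIn S (v.1, j) (v.1, j')) (fun j hj =>
        ⟨hmem _ huv₁ hj.1 le_rfl hj.2.le, hmem _ huv₁ (hj.1.trans (Order.le_succ j)) le_rfl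
          (Order.succ_le_of_lt hj.2), by simp [Adj]⟩) huv₂)
  exact hrows.trans hcols

theorem Connected.exists_mem_diagonal (hS : Connected S) (hu : u ∈ S) (hv : v ∈ S) {k : ℤ}
    (huk : u.1 - u.2 ≤ k) (hkv : k ≤ v.1 - v.2) : ∃ c ∈ S, c.1 - c.2 = k := by
  induction hS u hu v hv with
  | refl => exact ⟨u, hu, le_antisymm huk hkv⟩
  | @tail c d _ hcd ih =>
    by_cases hkc : k ≤ c.1 - c.2
    · exact ih hcd.1 hkc
    · have hadj : |c.1 - d.1| + |c.2 - d.2| = 1 := hcd.2.2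
      have := neg_abs_le (c.1 - d.1)
      have := le_abs_self (c.2 - d.2)
      exact ⟨d, hcd.2.1, by omega⟩

end Reachability

section Band

/-- `f` increases by zero or one at each of its first `N` steps; so do the first and the last
occupied row along consecutive diagonals of a connected skew shape. -/
def UnitSteps (f : ℕ → ℤ) (N : ℕ) : Prop :=
  ∀ n < N, f (n + 1) = f n ∨ f (n + 1) = f n + 1

/-- The set of cells whose diagonals are indexed by `0, …, N` and whose `n`-th diagonal occupies
the rows `a n, …, b n`. -/
noncomputable def band (a b : ℕ → ℤ) (N : ℕ) : Finset (ℤ × ℤ) :=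
  (Finset.range (N + 1)).biUnion fun n => (Finset.Icc (a n) (b n)).image fun i => (i, i - (n : ℤ))

/-- The conditions on `a` and `b` under which `band a b N` is a connected skew shape with extremal
diagonals `0` and `N`, each of which is then a single cell. -/
structure IsBoundary (a b : ℕ → ℤ) (N : ℕ) : Prop where
  unitSteps_fst : UnitSteps a N
  unitSteps_snd : UnitSteps b N
  le {n : ℕ} (hn : n ≤ N) : a n ≤ b n
  zero_eq : a 0 = b 0
  last_eq : a N = b N

variable {f a b a' b' : ℕ → ℤ} {N N' : ℕ}

theorem UnitSteps.le_add_max (hf : UnitSteps f N) {i j : ℕ} (hi : i ≤ N) (hj : j ≤ N) :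
    f j ≤ f i + max 0 ((j : ℤ) - i) := by
  rcases le_total i j with hij | hji
  · induction j, hij using Nat.le_induction with
    | base => simp
    | succ j hij ih =>
      have := ih (by omega)
      have := hf j (by omega)
      omega
  · induction i, hji using Nat.le_induction with
    | base => simp
    | succ i hji ih =>
      have := ih (by omega)
      have := hf i (by omega)
      omega

theorem UnitSteps.natCast_sub (hf : UnitSteps f N) : UnitSteps (fun n => n - f n) N := by
  intro n hn
  have := hf n hn
  push_cast
  omega

theorem UnitSteps.exists_eq (hf : UnitSteps f N) {v : ℤ} (h₀ : f 0 ≤ v) (hv : v ≤ f N) :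
    ∃ n ≤ N, f n = v := by
  induction N with
  | zero => exact ⟨0, le_rfl, le_antisymm h₀ hv⟩
  | succ N ih =>
    by_cases hvN : v ≤ f N
    · obtain ⟨n, hn, rfl⟩ := ih (fun n hn => hf n (hn.trans N.lt_succ_self)) hvN
      exact ⟨n, hn.trans N.le_succ, rfl⟩
    · have := hf N N.lt_succ_self
      exact ⟨N + 1, le_rfl, by omega⟩

theorem mem_band {c : ℤ × ℤ} :
    c ∈ band a b N ↔ ∃ n ≤ N, c.1 - c.2 = n ∧ a n ≤ c.1 ∧ c.1 ≤ b n := by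
  rcases c with ⟨i, j⟩
  simp only [band, Finset.mem_biUnion, Finset.mem_range_succ_iff, Finset.mem_image,
    Finset.mem_Icc, Prod.mk.injEq]
  refine exists_congr fun n => and_congr_right fun _ => ⟨?_, fun h => ⟨i, by omega⟩⟩
  rintro ⟨_, h, rfl, rfl⟩
  omega

theorem mk_mem_band {i : ℤ} {n : ℕ} (hn : n ≤ N) :
    (i, i - (n : ℤ)) ∈ band a b N ↔ a n ≤ i ∧ i ≤ b n := by
  refine mem_band.trans ⟨?_, fun h => ⟨n, hn, by omega, h⟩⟩
  rintro ⟨k, -, hk, h⟩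
  obtain rfl : n = k := by omega
  exact h

theorem band_congr (hab : ∀ n ≤ N, a n = a' n ∧ b n = b' n) : band a b N = band a' b' N :=
  Finset.biUnion_congr rfl fun n hn => by
    obtain ⟨ha, hb⟩ := hab n (Finset.mem_range_succ_iff.1 hn)
    rw [ha, hb]

theorem card_band (a b : ℕ → ℤ) (N : ℕ) :
    (band a b N).card = ∑ n ∈ Finset.range (N + 1), (b n + 1 - a n).toNat := by
  rw [band, Finset.card_biUnion]
  · refine Finset.sum_congr rfl fun n _ => ?_
    rw [Finset.card_image_of_injective _ fun i j hij => congrArg Prod.fst hij, Int.card_Icc]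
  · intro n _ k _ hnk
    simp only [Function.onFun, Finset.disjoint_left, Finset.mem_image]
    rintro _ ⟨i, _, rfl⟩ ⟨j, _, hij⟩
    rw [Prod.mk.injEq] at hij
    omega

theorem diagonal_band {n : ℕ} (hn : n ≤ N) :
    diagonal (band a b N) n = (Finset.Icc (a n) (b n)).image fun i => (i, i - (n : ℤ)) := by
  ext ⟨i, j⟩
  simp only [diagonal, Finset.mem_filter, Finset.mem_image, Finset.mem_Icc, Prod.mk.injEq]
  constructor
  · rintro ⟨hij, hk⟩
    obtain rfl : j = i - n := by omega
    exact ⟨i, (mk_mem_band hn).1 hij, rfl, rfl⟩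
  · rintro ⟨i, h, rfl, rfl⟩
    exact ⟨(mk_mem_band hn).2 h, by omega⟩

theorem diagonalsLE_band {m : ℕ} :
    DiagonalsLE m (band a b N) ↔ ∀ n ≤ N, b n + 1 - a n ≤ m := by
  have hcard (n : ℕ) (hn : n ≤ N) : (diagonal (band a b N) n).card = (b n + 1 - a n).toNat := by
    rw [diagonal_band hn, Finset.card_image_of_injective _ fun i j hij => congrArg Prod.fst hij,
      Int.card_Icc]
  constructor
  · intro h n hn
    have := hcard n hn ▸ h n
    omega
  · intro h k
    by_cases hk : ∃ n ≤ N, k = (n : ℤ)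
    · obtain ⟨n, hn, rfl⟩ := hk
      rw [hcard n hn]
      have := h n hn
      omega
    · have hempty : diagonal (band a b N) k = ∅ := by
        refine Finset.filter_false_of_mem fun c hc hck => hk ?_
        obtain ⟨n, hn, hcn, -⟩ := mem_band.1 hc
        exact ⟨n, hn, hck.symm.trans hcn⟩
      simp [hempty]

theorem UnitSteps.congr (hf : UnitSteps a N) (h : ∀ n ≤ N, a n = a' n) : UnitSteps a' N := by
  intro n hn
  rw [← h n hn.le, ← h (n + 1) hn]
  exact hf n hn

theorem IsBoundary.congr (h : IsBoundary a b N) (hab : ∀ n ≤ N, a n = a' n ∧ b n = b' n) :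
    IsBoundary a' b' N where
  unitSteps_fst := h.unitSteps_fst.congr fun n hn => (hab n hn).1
  unitSteps_snd := h.unitSteps_snd.congr fun n hn => (hab n hn).2
  le {n} hn := by rw [← (hab n hn).1, ← (hab n hn).2]; exact h.le hn
  zero_eq := by rw [← (hab 0 N.zero_le).1, ← (hab 0 N.zero_le).2, h.zero_eq]
  last_eq := by rw [← (hab N le_rfl).1, ← (hab N le_rfl).2, h.last_eq]

theorem IsBoundary.le_of_band_subset (h : IsBoundary a b N) (hsub : band a b N ⊆ band a' b' N')
    {n : ℕ} (hn : n ≤ N) : n ≤ N' ∧ a' n ≤ a n ∧ b n ≤ b' n := by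
  have hmem (i : ℤ) (hi : a n ≤ i ∧ i ≤ b n) : n ≤ N' ∧ a' n ≤ i ∧ i ≤ b' n := by
    obtain ⟨k, hk, hkn, hik⟩ := mem_band.1 (hsub ((mk_mem_band hn).2 hi))
    obtain rfl : n = k := by omega
    exact ⟨hk, hik⟩
  have ha := hmem (a n) ⟨le_rfl, h.le hn⟩
  have hb := hmem (b n) ⟨h.le hn, le_rfl⟩
  exact ⟨ha.1, ha.2.1, hb.2.2⟩

theorem IsBoundary.eq_of_band_eq (h : IsBoundary a b N) (h' : IsBoundary a' b' N')
    (heq : band a b N = band a' b' N') :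
    N = N' ∧ ∀ n ≤ N, a n = a' n ∧ b n = b' n := by
  refine ⟨le_antisymm (h.le_of_band_subset heq.subset le_rfl).1
    (h'.le_of_band_subset heq.superset le_rfl).1, fun n hn => ?_⟩
  obtain ⟨hn', ha, hb⟩ := h.le_of_band_subset heq.subset hn
  obtain ⟨-, ha', hb'⟩ := h'.le_of_band_subset heq.superset hn'
  exact ⟨le_antisymm ha' ha, le_antisymm hb hb'⟩

namespace IsBoundary

variable (h : IsBoundary a b N)
include h

theorem fst_mem_Icc {c : ℤ × ℤ} (hc : c ∈ band a b N) : c.1 ∈ Finset.Icc (a 0) (b N) := by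
  obtain ⟨n, hn, -, hac, hcb⟩ := mem_band.1 hc
  have ha := h.unitSteps_fst.le_add_max hn N.zero_le
  have hb := h.unitSteps_snd.le_add_max le_rfl hn
  rw [Finset.mem_Icc]
  omega

theorem snd_mem_Icc {c : ℤ × ℤ} (hc : c ∈ band a b N) :
    c.2 ∈ Finset.Icc (a N - (N : ℤ)) (b 0) := by
  obtain ⟨n, hn, hcn, hac, hcb⟩ := mem_band.1 hc
  have ha := h.unitSteps_fst.le_add_max hn le_rfl
  have hb := h.unitSteps_snd.le_add_max N.zero_le hn
  rw [Finset.mem_Icc]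
  omega

theorem row_band : row (band a b N) = (b N + 1 - a 0).toNat := by
  rw [row, ← Int.card_Icc]
  congr 1
  ext v
  refine ⟨fun hv => ?_, fun hv => ?_⟩
  · obtain ⟨c, hc, rfl⟩ := Finset.mem_image.1 hv
    exact h.fst_mem_Icc hc
  · rw [Finset.mem_Icc] at hv
    obtain ⟨n, hn, rfl⟩ := h.unitSteps_snd.exists_eq (h.zero_eq ▸ hv.1) hv.2
    exact Finset.mem_image.2 ⟨_, (mk_mem_band hn).2 ⟨h.le hn, le_rfl⟩, rfl⟩

theorem col_band : col (band a b N) = (b 0 + 1 - (a N - N)).toNat := by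
  rw [col, ← Int.card_Icc]
  congr 1
  ext v
  refine ⟨fun hv => ?_, fun hv => ?_⟩
  · obtain ⟨c, hc, rfl⟩ := Finset.mem_image.1 hv
    exact h.snd_mem_Icc hc
  · rw [Finset.mem_Icc, ← h.zero_eq] at hv
    obtain ⟨n, hn, hnv⟩ := h.unitSteps_fst.natCast_sub.exists_eq (v := -v)
      (by rw [Nat.cast_zero]; omega) (by omega)
    exact Finset.mem_image.2
      ⟨_, (mk_mem_band hn).2 ⟨le_rfl, h.le hn⟩, show a n - (n : ℤ) = v by omega⟩

theorem ordConnected_band : (band a b N : Set (ℤ × ℤ)).OrdConnected := by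
  refine ⟨fun u hu v hv c ⟨huc, hcv⟩ => ?_⟩
  have hu₁ := Finset.mem_Icc.1 (h.fst_mem_Icc hu)
  have hu₂ := Finset.mem_Icc.1 (h.snd_mem_Icc hu)
  have hv₁ := Finset.mem_Icc.1 (h.fst_mem_Icc hv)
  have hv₂ := Finset.mem_Icc.1 (h.snd_mem_Icc hv)
  obtain ⟨⟨huc₁, huc₂⟩, hcv₁, hcv₂⟩ := And.intro huc hcv
  have hzero := h.zero_eq
  have hlast := h.last_eq
  obtain ⟨k, hk⟩ : ∃ k : ℕ, c.1 - c.2 = k := Int.eq_ofNat_of_zero_le (by omega)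
  have hkN : k ≤ N := by omega
  obtain ⟨i, hi, hui, hau, -⟩ := mem_band.1 hu
  obtain ⟨j, hj, hvj, -, hvb⟩ := mem_band.1 hv
  have ha := h.unitSteps_fst.le_add_max hi hkN
  have hb := h.unitSteps_snd.le_add_max hkN hj
  exact mem_band.2 ⟨k, hkN, hk, by omega, by omega⟩

theorem connected_band : Connected (band a b N) := by
  let corner (n : ℕ) : ℤ × ℤ := (a n, a n - n)
  have hcorner (n : ℕ) (hn : n ≤ N) : corner n ∈ band a b N :=
    (mk_mem_band hn).2 ⟨le_rfl, h.le hn⟩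
  have hcorners (n : ℕ) (hn : n ≤ N) :
      Relation.ReflTransGen (AdjIn (band a b N)) (corner 0) (corner n) := by
    induction n with
    | zero => exact .refl
    | succ n ih =>
      refine (ih (by omega)).tail ⟨hcorner n (by omega), hcorner (n + 1) hn, ?_⟩
      rcases h.unitSteps_fst n hn with heq | heq <;> simp [corner, Adj, heq]
  have hreach (c : ℤ × ℤ) (hc : c ∈ band a b N) :
      Relation.ReflTransGen (AdjIn (band a b N)) (corner 0) c := by
    obtain ⟨n, hn, hcn, hac, -⟩ := mem_band.1 hc
    exact (hcorners n hn).trans (reflTransGen_adjIn_of_le h.ordConnected_band (hcorner n hn) hc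
      ⟨hac, show a n - (n : ℤ) ≤ c.2 by omega⟩)
  exact fun u hu v hv => (symm (hreach u hu)).trans (hreach v hv)

end IsBoundary

end Band

section DiagonalRows

/-- The rows of the cells of `S` on the diagonal `k`. -/
def diagonalRows (S : Finset (ℤ × ℤ)) (k : ℤ) : Set ℤ :=
  (fun i => (i, i - k)) ⁻¹' (S : Set (ℤ × ℤ))

/-- The first row of the diagonal `k` of `S`; it is `0` when this diagonal is empty. -/
noncomputable def firstRow (S : Finset (ℤ × ℤ)) (k : ℤ) : ℤ := sInf (diagonalRows S k)

/-- The last row of the diagonal `k` of `S`; it is `0` when this diagonal is empty. -/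
noncomputable def lastRow (S : Finset (ℤ × ℤ)) (k : ℤ) : ℤ := sSup (diagonalRows S k)

variable {S : Finset (ℤ × ℤ)} {k : ℤ}

theorem mem_diagonalRows {i : ℤ} : i ∈ diagonalRows S k ↔ (i, i - k) ∈ S := Iff.rfl

theorem finite_diagonalRows (S : Finset (ℤ × ℤ)) (k : ℤ) : (diagonalRows S k).Finite :=
  S.finite_toSet.preimage fun _ _ _ _ hij => congrArg Prod.fst hij

theorem firstRow_mem (hk : (diagonalRows S k).Nonempty) : firstRow S k ∈ diagonalRows S k :=
  hk.csInf_mem (finite_diagonalRows S k)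

theorem lastRow_mem (hk : (diagonalRows S k).Nonempty) : lastRow S k ∈ diagonalRows S k :=
  hk.csSup_mem (finite_diagonalRows S k)

theorem firstRow_le {i : ℤ} (hi : i ∈ diagonalRows S k) : firstRow S k ≤ i :=
  csInf_le (finite_diagonalRows S k).bddBelow hi

theorem le_lastRow {i : ℤ} (hi : i ∈ diagonalRows S k) : i ≤ lastRow S k :=
  le_csSup (finite_diagonalRows S k).bddAbove hi

section OrdConnected

variable (hS : (S : Set (ℤ × ℤ)).OrdConnected)
include hS

theorem diagonalRows_eq_Icc (hk : (diagonalRows S k).Nonempty) :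
    diagonalRows S k = Set.Icc (firstRow S k) (lastRow S k) := by
  have hmono : Monotone fun i : ℤ => (i, i - k) := fun i j hij => ⟨hij, sub_le_sub_right hij k⟩
  exact (hk.ordConnected_iff_of_bdd (finite_diagonalRows S k).bddBelow
    (finite_diagonalRows S k).bddAbove).1 (hS.preimage_mono hmono)

-- The rectangle spanned by the two cells contains the neighbours of both on the other diagonal.
theorem mem_diagonalRows_of_lt {i j : ℤ} (hi : i ∈ diagonalRows S k)
    (hj : j ∈ diagonalRows S (k + 1)) (hij : i < j) :
    i + 1 ∈ diagonalRows S (k + 1) ∧ j - 1 ∈ diagonalRows S k := by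
  rw [mem_diagonalRows] at *
  constructor <;> refine hS.out hi hj ⟨⟨?_, ?_⟩, ?_, ?_⟩ <;> simp only <;> omega

theorem mem_diagonalRows_of_le {i j : ℤ} (hi : i ∈ diagonalRows S k)
    (hj : j ∈ diagonalRows S (k + 1)) (hji : j ≤ i) :
    i ∈ diagonalRows S (k + 1) ∧ j ∈ diagonalRows S k := by
  rw [mem_diagonalRows] at *
  constructor <;> refine hS.out hj hi ⟨⟨?_, ?_⟩, ?_, ?_⟩ <;> simp only <;> omega

theorem firstRow_add_one (hk : (diagonalRows S k).Nonempty)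
    (hk' : (diagonalRows S (k + 1)).Nonempty) :
    firstRow S (k + 1) = firstRow S k ∨ firstRow S (k + 1) = firstRow S k + 1 := by
  rcases lt_or_ge (firstRow S k) (firstRow S (k + 1)) with hlt | hge
  · have := firstRow_le (mem_diagonalRows_of_lt hS (firstRow_mem hk) (firstRow_mem hk') hlt).1
    omega
  · have := firstRow_le (mem_diagonalRows_of_le hS (firstRow_mem hk) (firstRow_mem hk') hge).2
    omega

theorem lastRow_add_one (hk : (diagonalRows S k).Nonempty)
    (hk' : (diagonalRows S (k + 1)).Nonempty) :
    lastRow S (k + 1) = lastRow S k ∨ lastRow S (k + 1) = lastRow S k + 1 := by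
  rcases lt_or_ge (lastRow S k) (lastRow S (k + 1)) with hlt | hge
  · have := le_lastRow (mem_diagonalRows_of_lt hS (lastRow_mem hk) (lastRow_mem hk') hlt).2
    omega
  · have := le_lastRow (mem_diagonalRows_of_le hS (lastRow_mem hk) (lastRow_mem hk') hge).1
    omega

-- A second cell on the diagonal would produce cells on both neighbouring diagonals.
theorem firstRow_eq_lastRow (hk : (diagonalRows S k).Nonempty)
    (hext : diagonalRows S (k - 1) = ∅ ∨ diagonalRows S (k + 1) = ∅) :
    firstRow S k = lastRow S k := by
  refine le_antisymm (firstRow_le (lastRow_mem hk)) (not_lt.1 fun hlt => ?_)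
  have hmem (c : ℤ × ℤ) (hc : (firstRow S k, firstRow S k - k) ≤ c)
      (hc' : c ≤ (lastRow S k, lastRow S k - k)) : c ∈ S :=
    hS.out (firstRow_mem hk) (lastRow_mem hk) ⟨hc, hc'⟩
  rcases hext with hempty | hempty
  · have : firstRow S k ∈ diagonalRows S (k - 1) :=
      hmem _ ⟨le_rfl, by simp only; omega⟩ ⟨hlt.le, by simp only; omega⟩
    simp [hempty] at this
  · have : firstRow S k + 1 ∈ diagonalRows S (k + 1) :=
      hmem _ ⟨by simp, by simp⟩ ⟨hlt, by simp only; omega⟩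
    simp [hempty] at this

theorem isBoundary_firstRow_lastRow {N : ℕ} (hrows : ∀ n ≤ N, (diagonalRows S (k + n)).Nonempty)
    (hfirst : diagonalRows S (k - 1) = ∅) (hlast : diagonalRows S (k + N + 1) = ∅) :
    IsBoundary (fun n => firstRow S (k + n) - firstRow S k)
      (fun n => lastRow S (k + n) - firstRow S k) N where
  unitSteps_fst n hn := by
    have hstep := firstRow_add_one hS (hrows n hn.le) (by simpa [add_assoc] using hrows (n + 1) hn)
    push_cast
    rw [← add_assoc]
    omega
  unitSteps_snd n hn := by
    have hstep := lastRow_add_one hS (hrows n hn.le) (by simpa [add_assoc] using hrows (n + 1) hn)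
    push_cast
    rw [← add_assoc]
    omega
  le hn := sub_le_sub_right (firstRow_le (lastRow_mem (hrows _ hn))) _
  zero_eq := by
    rw [firstRow_eq_lastRow hS (hrows 0 N.zero_le) (.inl (by simpa using hfirst))]
  last_eq := by
    rw [firstRow_eq_lastRow hS (hrows N le_rfl) (.inr hlast)]

theorem eq_translate_band {N : ℕ} (hrows : ∀ n ≤ N, (diagonalRows S (k + n)).Nonempty)
    (hdiag : ∀ c ∈ S, c.1 - c.2 ∈ Set.Icc k (k + N)) :
    S = translate (firstRow S k, firstRow S k - k)
      (band (fun n => firstRow S (k + n) - firstRow S k)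
        (fun n => lastRow S (k + n) - firstRow S k) N) := by
  have hmem (n : ℕ) (hn : n ≤ N) (i : ℤ) :
      (i, i - (k + n)) ∈ S ↔ firstRow S (k + n) ≤ i ∧ i ≤ lastRow S (k + n) :=
    Set.ext_iff.1 (diagonalRows_eq_Icc hS (hrows n hn)) i
  ext ⟨i, j⟩
  simp only [mem_translate, mem_band, Prod.fst_sub, Prod.snd_sub, sub_le_sub_iff_right]
  constructor
  · intro hij
    have := hdiag _ hij
    obtain ⟨n, hn⟩ := Int.eq_ofNat_of_zero_le (sub_nonneg.2 this.1)
    obtain rfl : j = i - (k + n) := by omega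
    have hnN : n ≤ N := by simp only [Set.mem_Icc] at this; omega
    exact ⟨n, hnN, by omega, (hmem n hnN i).1 hij⟩
  · rintro ⟨n, hn, hij, h⟩
    obtain rfl : j = i - (k + n) := by omega
    exact (hmem n hn i).2 h

theorem exists_eq_translate_band (hconn : Connected S) (hne : S.Nonempty) :
    ∃ (v : ℤ × ℤ) (a b : ℕ → ℤ) (N : ℕ),
      IsBoundary a b N ∧ a 0 = 0 ∧ S = translate v (band a b N) := by
  obtain ⟨u, hu, hmin⟩ := S.exists_min_image (fun c => c.1 - c.2) hne
  obtain ⟨w, hw, hmax⟩ := S.exists_max_image (fun c => c.1 - c.2) hne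
  obtain ⟨N, hN⟩ := Int.eq_ofNat_of_zero_le (sub_nonneg.2 (hmin w hw))
  have hrows (n : ℕ) (hn : n ≤ N) : (diagonalRows S (u.1 - u.2 + n)).Nonempty := by
    obtain ⟨c, hc, hcn⟩ :=
      hconn.exists_mem_diagonal (k := u.1 - u.2 + n) hu hw (by omega) (by omega)
    exact ⟨c.1, by rwa [mem_diagonalRows, ← hcn, sub_sub_cancel]⟩
  have hdiag (c : ℤ × ℤ) (hc : c ∈ S) : c.1 - c.2 ∈ Set.Icc (u.1 - u.2) (u.1 - u.2 + N) :=
    ⟨hmin c hc, (hmax c hc).trans (by omega)⟩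
  have hempty (k : ℤ) (hk : k ∉ Set.Icc (u.1 - u.2) (u.1 - u.2 + N)) : diagonalRows S k = ∅ :=
    Set.eq_empty_of_forall_notMem fun i hi => hk (sub_sub_cancel i k ▸ hdiag _ hi)
  exact ⟨_, _, _, N, isBoundary_firstRow_lastRow hS hrows
    (hempty _ (by simp)) (hempty _ (by simp)), by simp, eq_translate_band hS hrows hdiag⟩

end OrdConnected

end DiagonalRows

theorem connected_translate_iff {S : Finset (ℤ × ℤ)} {v : ℤ × ℤ} :
    Connected (translate v S) ↔ Connected S := by
  refine ⟨fun h => ?_, fun h => h.translate v⟩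
  simpa only [translate_translate, add_neg_cancel, translate_zero] using h.translate (-v)

theorem diagonalsLE_translate_iff {m : ℕ} {S : Finset (ℤ × ℤ)} {v : ℤ × ℤ} :
    DiagonalsLE m (translate v S) ↔ DiagonalsLE m S := by
  refine ⟨fun h => ?_, fun h => h.translate v⟩
  simpa only [translate_translate, add_neg_cancel, translate_zero] using h.translate (-v)

end Cells

namespace SkewDiagram

theorem mem_cells {s : SkewDiagram} {c : ℤ × ℤ} :
    c ∈ s.cells ↔ ∃ p ∈ s.outer.cells \ s.inner.cells, ((p.1 : ℤ), (p.2 : ℤ)) = c :=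
  Finset.mem_image

theorem ordConnected_sdiff (s : SkewDiagram) :
    ((s.outer.cells \ s.inner.cells : Finset (ℕ × ℕ)) : Set (ℕ × ℕ)).OrdConnected := by
  rw [Finset.coe_sdiff]
  exact s.outer.isLowerSet.ordConnected.inter s.inner.isLowerSet.compl.ordConnected

theorem ordConnected_cells (s : SkewDiagram) : (s.cells : Set (ℤ × ℤ)).OrdConnected := by
  refine ⟨fun c hc e he d ⟨⟨hcd₁, hcd₂⟩, hde₁, hde₂⟩ => ?_⟩
  obtain ⟨p, hp, rfl⟩ := mem_cells.1 hc
  obtain ⟨r, hr, rfl⟩ := mem_cells.1 he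
  simp only at *
  refine mem_cells.2 ⟨(d.1.toNat, d.2.toNat), s.ordConnected_sdiff.out hp hr
    ⟨⟨?_, ?_⟩, ?_, ?_⟩, Prod.ext ?_ ?_⟩ <;> simp only <;> omega

theorem exists_sdiff_eq {T : Finset (ℕ × ℕ)} (hT : (T : Set (ℕ × ℕ)).OrdConnected) :
    ∃ s : SkewDiagram, s.outer.cells \ s.inner.cells = T := by
  classical
  let outer : YoungDiagram := ⟨T.biUnion Finset.Iic, by
    rw [Finset.coe_biUnion]
    simpa using isLowerSet_iUnion₂ fun t _ => isLowerSet_Iic t⟩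
  let inner : YoungDiagram := ⟨outer.cells.filter fun p => ∀ t ∈ T, ¬ t ≤ p, by
    simp only [Finset.coe_filter]
    exact outer.isLowerSet.inter fun p r hrp hp t ht htr => hp t ht (htr.trans hrp)⟩
  refine ⟨⟨outer, inner, Finset.filter_subset _ _⟩, ?_⟩
  ext p
  have houter : p ∈ outer.cells ↔ ∃ t ∈ T, p ≤ t := by simp [outer]
  have hinner : p ∈ inner.cells ↔ p ∈ outer.cells ∧ ∀ t ∈ T, ¬ t ≤ p := Finset.mem_filter
  rw [Finset.mem_sdiff, hinner]
  refine ⟨fun ⟨hp, hlow⟩ => ?_, fun hp => ⟨houter.2 ⟨p, hp, le_rfl⟩, fun h => h.2 p hp le_rfl⟩⟩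
  obtain ⟨t, ht, hpt⟩ := houter.1 hp
  obtain ⟨r, hr, hrp⟩ : ∃ r ∈ T, r ≤ p := by
    by_contra! h
    exact hlow ⟨hp, h⟩
  exact hT.out hr ht ⟨hrp, hpt⟩

theorem exists_cells_eq_translate {S : Finset (ℤ × ℤ)} (hS : (S : Set (ℤ × ℤ)).OrdConnected) :
    ∃ (s : SkewDiagram) (v : ℤ × ℤ), s.cells = Cells.translate v S := by
  obtain ⟨b, hb⟩ := S.finite_toSet.bddBelow
  let shift (p : ℕ × ℕ) : ℤ × ℤ := ((p.1 : ℤ), (p.2 : ℤ)) + b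
  have hmono : Monotone shift := fun p r hpr => by
    obtain ⟨h₁, h₂⟩ := hpr
    exact add_le_add_left (Prod.mk_le_mk.2 ⟨Int.ofNat_le.2 h₁, Int.ofNat_le.2 h₂⟩) b
  have hinj : Function.Injective shift := by
    rintro ⟨i, j⟩ ⟨i', j'⟩ h
    simpa [shift] using h
  obtain ⟨s, hs⟩ := exists_sdiff_eq (T := S.preimage shift hinj.injOn) (by
    rw [Finset.coe_preimage]
    exact hS.preimage_mono hmono)
  refine ⟨s, -b, ?_⟩
  ext c
  rw [mem_cells, hs, Cells.mem_translate, sub_neg_eq_add]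
  constructor
  · rintro ⟨p, hp, rfl⟩
    exact Finset.mem_preimage (f := shift).1 hp
  · intro hc
    obtain ⟨p, hp⟩ : ∃ p : ℕ × ℕ, ((p.1 : ℤ), (p.2 : ℤ)) = c := by
      obtain ⟨h₁, h₂⟩ := hb hc
      simp only [Prod.fst_add, Prod.snd_add] at h₁ h₂
      exact ⟨(c.1.toNat, c.2.toNat), Prod.ext (by simp only; omega) (by simp only; omega)⟩
    exact ⟨p, Finset.mem_preimage.2 (by simpa only [shift, hp] using hc), hp⟩

end SkewDiagram

namespace SkewShape

/-- The skew shape whose diagrams are the translates of `S`. -/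
noncomputable def ofCells (S : Finset (ℤ × ℤ)) (hS : (S : Set (ℤ × ℤ)).OrdConnected) :
    SkewShape :=
  Quotient.mk _ (SkewDiagram.exists_cells_eq_translate hS).choose

section OfCells

variable {S T : Finset (ℤ × ℤ)} {hS : (S : Set (ℤ × ℤ)).OrdConnected}

theorem exists_ofCells_eq_mk (hS : (S : Set (ℤ × ℤ)).OrdConnected) :
    ∃ (s : SkewDiagram) (v : ℤ × ℤ),
      s.cells = Cells.translate v S ∧ ofCells S hS = Quotient.mk _ s :=
  ⟨_, _, (SkewDiagram.exists_cells_eq_translate hS).choose_spec.choose_spec, rfl⟩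

theorem row_ofCells : (ofCells S hS).row = Cells.row S := by
  obtain ⟨s, v, hs, heq⟩ := exists_ofCells_eq_mk hS
  rw [heq, ← Cells.row_translate v S, ← hs]
  rfl

theorem col_ofCells : (ofCells S hS).col = Cells.col S := by
  obtain ⟨s, v, hs, heq⟩ := exists_ofCells_eq_mk hS
  rw [heq, ← Cells.col_translate v S, ← hs]
  rfl

theorem area_ofCells : (ofCells S hS).area = S.card := by
  obtain ⟨s, v, hs, heq⟩ := exists_ofCells_eq_mk hS
  rw [heq, ← Cells.card_translate v S, ← hs]
  rfl

theorem connected_ofCells : (ofCells S hS).Connected ↔ Cells.Connected S := by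
  obtain ⟨s, v, hs, heq⟩ := exists_ofCells_eq_mk hS
  rw [heq, ← Cells.connected_translate_iff (v := v), ← hs]
  rfl

theorem diagonalsLE_ofCells {m : ℕ} : (ofCells S hS).DiagonalsLE m ↔ Cells.DiagonalsLE m S := by
  obtain ⟨s, v, hs, heq⟩ := exists_ofCells_eq_mk hS
  rw [heq, ← Cells.diagonalsLE_translate_iff (v := v), ← hs]
  rfl

theorem ofCells_eq_iff (hS : (S : Set (ℤ × ℤ)).OrdConnected)
    (hT : (T : Set (ℤ × ℤ)).OrdConnected) :
    ofCells S hS = ofCells T hT ↔ ∃ v, T = Cells.translate v S := by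
  obtain ⟨s, v, hs, hs'⟩ := exists_ofCells_eq_mk hS
  obtain ⟨t, w, ht, ht'⟩ := exists_ofCells_eq_mk hT
  rw [hs', ht']
  refine Quotient.eq.trans ?_
  constructor
  · rintro ⟨u, hu⟩
    refine ⟨v + u + -w, ?_⟩
    rw [← Cells.translate_translate, ← Cells.translate_translate, ← hs, ← hu, ht,
      Cells.translate_translate, add_neg_cancel, Cells.translate_zero]
  · rintro ⟨u, rfl⟩
    exact ⟨-v + u + w, by simp [hs, ht, Cells.translate_translate, add_assoc]⟩

theorem exists_ofCells_eq (α : SkewShape) :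
    ∃ (S : Finset (ℤ × ℤ)) (hS : (S : Set (ℤ × ℤ)).OrdConnected), ofCells S hS = α := by
  induction α using Quotient.inductionOn with
  | h s =>
    obtain ⟨t, v, ht, ht'⟩ := exists_ofCells_eq_mk s.ordConnected_cells
    exact ⟨s.cells, s.ordConnected_cells, ht'.trans (Quotient.sound (Setoid.symm ⟨v, ht⟩))⟩

end OfCells

end SkewShape

namespace SkewGF

open Cells

section PathsAndBands

variable {p : Step → Bool} {s : ℤ} {l l' : List Step} {m n : ℕ}

theorem boundary_succ (p : Step → Bool) (s : ℤ) (hn : n < l.length) :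
    boundary p s l (n + 1) = boundary p s l n + (p l[n]).toNat := by
  rw [boundary, boundary, ← List.take_concat_get' l n hn, List.countP_append]
  cases h : p l[n] <;> simp [h, add_assoc]

theorem unitSteps_boundary (p : Step → Bool) (s : ℤ) (l : List Step) :
    UnitSteps (boundary p s l) l.length := by
  intro n hn
  rw [boundary_succ p s hn]
  cases p l[n] <;> simp

theorem boundary_map_range {f : ℕ → ℤ} {N : ℕ} {g : ℕ → Step}
    (hf : ∀ n < N, f (n + 1) = f n + (p (g n)).toNat) (hn : n ≤ N) :
    boundary p (f 0) ((List.range N).map g) n = f n := by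
  induction n with
  | zero => exact boundary_zero _ _ _
  | succ n ih => rw [boundary_succ _ _ (by simpa using hn), ih (by omega), hf n hn]; simp

theorem exists_boundary_eq {a b : ℕ → ℤ} {N : ℕ} (ha : UnitSteps a N) (hb : UnitSteps b N) :
    ∃ l : List Step, l.length = N ∧
      ∀ n ≤ N, a n = boundary Prod.fst (a 0) l n ∧ b n = boundary Prod.snd (b 0) l n := by
  have hstep {f : ℕ → ℤ} (hf : UnitSteps f N) (n : ℕ) (hn : n < N) :
      f (n + 1) = f n + (decide (f n < f (n + 1))).toNat := by
    rcases hf n hn with heq | heq <;> simp [heq]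
  exact ⟨(List.range N).map fun n => (decide (a n < a (n + 1)), decide (b n < b (n + 1))),
    by simp, fun n hn =>
      ⟨(boundary_map_range (hstep ha) hn).symm, (boundary_map_range (hstep hb) hn).symm⟩⟩

theorem eq_of_boundary_eq (hlen : l.length = l'.length)
    (heq : ∀ n ≤ l.length, boundary Prod.fst 0 l n = boundary Prod.fst 0 l' n ∧
      boundary Prod.snd 0 l n = boundary Prod.snd 0 l' n) : l = l' := by
  refine List.ext_getElem hlen fun n hn hn' => ?_
  obtain ⟨hfst, hsnd⟩ := heq n hn.le
  obtain ⟨hfst', hsnd'⟩ := heq (n + 1) hn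
  rw [boundary_succ _ _ hn, boundary_succ _ _ hn', hfst] at hfst'
  rw [boundary_succ _ _ hn, boundary_succ _ _ hn', hsnd] at hsnd'
  have htoNat : Function.Injective Bool.toNat := by decide
  exact Prod.ext (htoNat (by omega)) (htoNat (by omega))

/-- The cells of the skew shape encoded by `l`: its `n`-th diagonal joins the two boundaries after
`n` steps, both of which start in row `0`. -/
noncomputable def cellsOf (l : List Step) : Finset (ℤ × ℤ) :=
  band (boundary Prod.fst 0 l) (boundary Prod.snd 0 l) l.length

theorem mem_paths_iff : l ∈ paths m 0 ↔
    IsBoundary (boundary Prod.fst 0 l) (boundary Prod.snd 0 l) l.length ∧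
      DiagonalsLE (m + 1) (cellsOf l) := by
  rw [cellsOf, diagonalsLE_band]
  simp only [paths, Set.mem_ofPred_eq, height, Set.mem_Icc]
  constructor
  · rintro ⟨hIcc, hlast⟩
    refine ⟨⟨unitSteps_boundary _ _ _, unitSteps_boundary _ _ _, fun hn => ?_, by simp, by omega⟩,
      fun n hn => ?_⟩
    · have := hIcc _ hn
      omega
    · have := hIcc n hn
      omega
  · rintro ⟨h, hdiag⟩
    refine ⟨fun n hn => ?_, sub_eq_zero.2 h.last_eq.symm⟩
    have := h.le hn
    have := hdiag n hn
    omega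

theorem isBoundary_of_mem_paths (hl : l ∈ paths m 0) :
    IsBoundary (boundary Prod.fst 0 l) (boundary Prod.snd 0 l) l.length :=
  (mem_paths_iff.1 hl).1

theorem ordConnected_cellsOf (hl : l ∈ paths m 0) : (cellsOf l : Set (ℤ × ℤ)).OrdConnected :=
  (isBoundary_of_mem_paths hl).ordConnected_band

theorem connected_cellsOf (hl : l ∈ paths m 0) : Connected (cellsOf l) :=
  (isBoundary_of_mem_paths hl).connected_band

theorem card_cellsOf (l : List Step) : (cellsOf l).card = pathArea 0 l := by
  rw [cellsOf, card_band]
  exact Finset.sum_congr rfl fun n _ => by rw [height, sub_add_eq_add_sub]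

theorem row_cellsOf (hl : l ∈ paths m 0) : row (cellsOf l) = l.countP Prod.snd + 1 := by
  rw [cellsOf, (isBoundary_of_mem_paths hl).row_band, boundary_zero, boundary_length]
  omega

theorem col_cellsOf (hl : l ∈ paths m 0) : col (cellsOf l) = l.countP (fun e => !e.1) + 1 := by
  have hlen : l.length = l.countP Prod.fst + l.countP (fun e => !e.1) := by
    simpa using l.length_eq_countP_add_countP Prod.fst
  rw [cellsOf, (isBoundary_of_mem_paths hl).col_band, boundary_zero, boundary_length]
  omega

theorem zero_mem_cellsOf (l : List Step) : (0 : ℤ × ℤ) ∈ cellsOf l :=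
  mem_band.2 ⟨0, by simp⟩

theorem nonneg_and_nonpos_of_mem_cellsOf (hl : l ∈ paths m 0) {c : ℤ × ℤ} (hc : c ∈ cellsOf l) :
    0 ≤ c.1 ∧ c.2 ≤ 0 := by
  have h := isBoundary_of_mem_paths hl
  have hfst := (Finset.mem_Icc.1 (h.fst_mem_Icc hc)).1
  have hsnd := (Finset.mem_Icc.1 (h.snd_mem_Icc hc)).2
  rw [boundary_zero] at hfst hsnd
  exact ⟨hfst, hsnd⟩

theorem eq_of_cellsOf_eq_translate (hl : l ∈ paths m 0) (hl' : l' ∈ paths m 0) {v : ℤ × ℤ}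
    (h : cellsOf l' = translate v (cellsOf l)) : l = l' := by
  have hv : v = 0 := by
    have hpos := nonneg_and_nonpos_of_mem_cellsOf hl' (c := v) (by
      rw [h, mem_translate, sub_self]
      exact zero_mem_cellsOf l)
    have hneg := nonneg_and_nonpos_of_mem_cellsOf hl (c := 0 - v) (by
      rw [← mem_translate, ← h]
      exact zero_mem_cellsOf l')
    simp only [Prod.fst_sub, Prod.snd_sub, Prod.fst_zero, Prod.snd_zero] at hneg
    exact Prod.ext (by simp only [Prod.fst_zero]; omega) (by simp only [Prod.snd_zero]; omega)
  rw [hv, translate_zero] at h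
  obtain ⟨hlen, heq⟩ :=
    (isBoundary_of_mem_paths hl).eq_of_band_eq (isBoundary_of_mem_paths hl') h.symm
  exact eq_of_boundary_eq hlen heq

theorem exists_mem_paths_eq_translate {S : Finset (ℤ × ℤ)}
    (hS : (S : Set (ℤ × ℤ)).OrdConnected) (hconn : Connected S) (hne : S.Nonempty)
    (hdiag : DiagonalsLE (m + 1) S) : ∃ l ∈ paths m 0, ∃ v, S = translate v (cellsOf l) := by
  obtain ⟨v, a, b, N, h, ha, rfl⟩ := exists_eq_translate_band hS hconn hne
  obtain ⟨l, rfl, hl⟩ := exists_boundary_eq h.unitSteps_fst h.unitSteps_snd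
  rw [← h.zero_eq, ha] at hl
  have hband : band a b l.length = cellsOf l := band_congr hl
  rw [hband] at hdiag ⊢
  exact ⟨l, mem_paths_iff.2 ⟨h.congr hl, diagonalsLE_translate_iff.1 hdiag⟩, v, rfl⟩

end PathsAndBands

section Encoding

/-- The skew shape encoded by a path. -/
noncomputable def shapeOf (m : ℕ) (l : paths m 0) : SkewShape.CSle (m + 1) :=
  ⟨SkewShape.ofCells (cellsOf l) (ordConnected_cellsOf l.2),
    ⟨by
      rw [SkewShape.area_ofCells]
      exact Finset.card_pos.2 ⟨0, zero_mem_cellsOf l⟩,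
    SkewShape.connected_ofCells.2 (connected_cellsOf l.2)⟩,
    SkewShape.diagonalsLE_ofCells.2 (mem_paths_iff.1 l.2).2⟩

theorem shapeOf_bijective (m : ℕ) : Function.Bijective (shapeOf m) := by
  refine ⟨fun l l' h => ?_, fun ⟨α, ⟨hpos, hconn⟩, hdiag⟩ => ?_⟩
  · obtain ⟨v, hv⟩ := (SkewShape.ofCells_eq_iff (ordConnected_cellsOf l.2)
      (ordConnected_cellsOf l'.2)).1 (congrArg Subtype.val h)
    exact Subtype.ext (eq_of_cellsOf_eq_translate l.2 l'.2 hv)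
  · obtain ⟨S, hS, rfl⟩ := α.exists_ofCells_eq
    rw [SkewShape.area_ofCells, Finset.card_pos] at hpos
    rw [SkewShape.connected_ofCells] at hconn
    rw [SkewShape.diagonalsLE_ofCells] at hdiag
    obtain ⟨l, hl, v, hv⟩ := exists_mem_paths_eq_translate hS hconn hpos hdiag
    exact ⟨⟨l, hl⟩,
      Subtype.ext ((SkewShape.ofCells_eq_iff (ordConnected_cellsOf hl) hS).2 ⟨v, hv⟩)⟩

theorem term_shapeOf {m : ℕ} (l : paths m 0) :
    x ^ (shapeOf m l).1.col * y ^ (shapeOf m l).1.row * q ^ (shapeOf m l).1.area =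
      x * y * weight 0 l := by
  rw [shapeOf, SkewShape.col_ofCells, SkewShape.row_ofCells, SkewShape.area_ofCells,
    col_cellsOf l.2, row_cellsOf l.2, card_cellsOf, weight_eq]
  ring

end Encoding

end SkewGF

theorem mainTheorem3 (m : ℕ) :
    HasSum (fun α : SkewShape.CSle (m + 1) =>
        SkewGF.x ^ α.1.col * SkewGF.y ^ α.1.row * SkewGF.q ^ α.1.area)
      (SkewGF.contFrac m 0) := by
  rw [← (Equiv.ofBijective _ (SkewGF.shapeOf_bijective m)).hasSum_iff, ← SkewGF.mul_pathSum_zero]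
  have hpaths : HasSum (fun l : SkewGF.paths m 0 => SkewGF.weight 0 l) (SkewGF.pathSum m 0) :=
    hasSum_subtype_iff_indicator.2 (SkewGF.hasSum_pathSum m 0)
  exact (hpaths.mul_left (SkewGF.x * SkewGF.y)).congr_fun SkewGF.term_shapeOf
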